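/- Let $K$ be a field, let $n,i_1,i_2,t_2$ be integers with $1\le i_1,i_2\le n-2$ and $0\le t_2\le n-1$, put $[i]=\{1,\dots,i\}$, let $\sigma=(1,2,\dots,n)\in S_n$ be the $n$-cycle, and let $\sigma^{t}[i]=\{\sigma^{t}(1),\dots,\sigma^{t}(i)\}$. For nonempty sets $C_1,\dots,C_m\subseteq[n]$ with $m\ge 2$, the transversal polymatroid presented by $\mathcal C=\{C_1,\dots,C_m\}$ has as its base the set of vectors $e_{j_1}+\dots+e_{j_m}\in\mathbb N^n$ with $j_k\in C_k$ for all $k$, and its base ring is the subalgebra $K[\mathcal C]=K[x_{j_1}\cdots x_{j_m} : j_k\in C_k,\ 1\le k\le m]$ of $K[x_1,\dots,x_n]$. Let $\mathcal A=\{A_1,\dots,A_n\}$ and $\mathcal B=\{B_1,\dots,B_n\}$, where $$A_k=[n]\ \text{ if } k\in[i_1]\cup\{n\},\qquad A_k=[n]\setminus[i_1]\ \text{ if } k\in[n-1]\setminus[i_1],$$ $$B_{\sigma^{t_2}(k)}=[n]\ \text{ if } k\in[i_2]\cup\{n\},\qquad B_{\sigma^{t_2}(k)}=[n]\setminus\sigma^{t_2}[i_2]\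 \text{ if } k\in[n-1]\setminus[i_2].$$ Let $A,B\subset\mathbb N^n$ be the sets of exponent vectors of the monomials $x_{j_1}\cdots x_{j_n}$ with $j_k\in A_k$ for all $k$, respectively $j_k\in B_k$ for all $k$, and let $K[A\cap B]$ be the $K$-subalgebra of $K[x_1,\dots,x_n]$ generated by the monomials $x^\alpha$ with $\alpha\in A\cap B$. Then $K[A\cap B]$ is the base ring $K[\mathcal C]$ of a transversal polymatroid presented by some family $\mathcal C$ of $m\ge 2$ nonempty subsets of $[n]$ if and only if one of the following conditions holds: (a) $i_1=1$; (b) $i_1\ge 2$ and $t_2=0$; (c) $i_1\ge 2$ and $t_2=i_1$; (d) $i_1\ge 2$, $1\le t_2\le i_1-1$ and $i_2\in\{1,\dots,i_1-t_2\}\cup\{n-t_2,\dots,n-2\}$; (e) $i_1\ge 2$, $i_1+1\le t_2\le n-1$ and $i_2\in\{1,\dots,n-t_2\}\cup\{n-t_2+i_1,\dots,n-2\}$. Here $\{a,\dots,b\}$ is empty if $a>b$. -/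

import Mathlib

namespace TransversalPolymatroid

/-- The `n`-cycle `σ = (1, 2, …, n)`. The set `[n] = {1, …, n}` is modelled by `Fin n`,
the number `k` being the element of `Fin n` with value `k - 1`. -/
def sigma (n : ℕ) : Equiv.Perm (Fin n) := finRotate n

/-- The subset `[i] = {1, …, i}` of `[n]`. -/
def initial (n i : ℕ) : Finset (Fin n) := Finset.univ.filter fun k => k.val < i

/-- The subset `σ^t[i] = {σ^t(1), …, σ^t(i)}` of `[n]`. -/
def sigmaSet (n t i : ℕ) : Finset (Fin n) := (initial n i).image fun k => (sigma n ^ t) k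

/-- The presentation `{A_1, …, A_n}` with `A_{σ^t(k)} = [n]` for `k ∈ [i] ∪ {n}` and
`A_{σ^t(k)} = [n] ∖ σ^t[i]` for `k ∈ [n-1] ∖ [i]`. Here `j = σ^t(k)`, so `k = (σ^t)⁻¹(j)`. -/
def presentation (n t i : ℕ) (j : Fin n) : Finset (Fin n) :=
  if (sigma n ^ t)⁻¹ j ∈ initial n i ∨ ((sigma n ^ t)⁻¹ j).val + 1 = n then Finset.univ
  else Finset.univ \ sigmaSet n t i

/-- The set of vectors `e_{i_1} + ⋯ + e_{i_m}` with `i_k ∈ C_k`: the base of the transversal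
polymatroid presented by `C`, that is, the exponent vectors of the generators of its base ring. -/
def exponents {n m : ℕ} (C : Fin m → Finset (Fin n)) : Set (Fin n →₀ ℕ) :=
  {α | ∃ f : Fin m → Fin n, (∀ k, f k ∈ C k) ∧ α = ∑ k, Finsupp.single (f k) 1}

/-- `K[S]`: the `K`-subalgebra of `K[x_1, …, x_n]` generated by the monomials `x^α`, `α ∈ S`. -/
noncomputable def monomialAlgebra (K : Type*) [Field K] {n : ℕ} (S : Set (Fin n →₀ ℕ)) :
    Subalgebra K (MvPolynomial (Fin n) K) :=
  Algebra.adjoin K ((fun α => MvPolynomial.monomial α (1 : K)) '' S)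

/-- The base ring `K[C] = K[x_{i_1} ⋯ x_{i_m} | i_k ∈ C_k]` of the transversal polymatroid
presented by `C`. -/
noncomputable def baseRing (K : Type*) [Field K] {n m : ℕ} (C : Fin m → Finset (Fin n)) :
    Subalgebra K (MvPolynomial (Fin n) K) :=
  monomialAlgebra K (exponents C)

/-- The subalgebra `R` of `K[x_1, …, x_n]` is the base ring of a transversal polymatroid on `[n]`,
presented by some family of `m ≥ 2` nonempty subsets of `[n]`. -/
def IsTransversalBaseRing (K : Type*) [Field K] {n : ℕ}
    (R : Subalgebra K (MvPolynomial (Fin n) K)) : Prop :=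
  ∃ m : ℕ, 2 ≤ m ∧ ∃ C : Fin m → Finset (Fin n), (∀ k, (C k).Nonempty) ∧ R = baseRing K C

end TransversalPolymatroid

/-!
Write `S₁ = [i₁]` and `S₂ = σ^{t₂}[i₂]`. By Hall's theorem `A ∩ B` consists of the vectors `α` of
degree `n` with `α(S₁) ≤ |S₁| + 1` and `α(S₂) ≤ |S₂| + 1`, where `α(T) = ∑ j ∈ T, α j`. Since the
generators of a base ring are monomials of one common degree, they are determined by the ring
(`eq_of_monomialAlgebra_eq`), so the question is whether `A ∩ B` is the base of a transversal
polymatroid. The answer is that this happens precisely when `S₁` and `S₂` do not cross: one contains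
the other, or they are disjoint, or they cover `[n]`. For two cyclic intervals this is the list of
arithmetic conditions in the theorem.

If `S₁` and `S₂` do not cross, take index sets `P₁`, `P₂` with `|Pᵢ| = |Sᵢᶜ| - 1` and present the
polymatroid by `C k = [n] ∖ ⋃ {Sᵢ | k ∈ Pᵢ}`. By Hall's theorem (`mem_exponents_meetFamily_iff`)
its base is cut out by the inequalities `|Pᵢ| ≤ α(Sᵢᶜ)`, `|P₁ ∩ P₂| ≤ α(S₁ᶜ ∩ S₂ᶜ)` and
`|P₁ ∪ P₂| ≤ α(S₁ᶜ ∪ S₂ᶜ)`, and `P₁`, `P₂` can be chosen so that the last two follow from the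
first two.

If they cross, suppose that `C` is a presentation. The number `r(T)` of the sets `C k` that meet `T`
is the maximum of `α(T)` over the base, and `r` is submodular (`hitCount_submodular`). But
`r(Sᵢ) ≤ |Sᵢ| + 1`, while vectors supported on one point of each part of the Venn diagram show
`r(S₁ ∩ S₂) ≥ min |Sᵢ| + 1` and `r(S₁ ∪ S₂) ≥ min(n, |S₁| + |S₂| + 2)`, which contradicts
submodularity because `|Sᵢ| ≤ n - 2`.
-/

namespace TransversalPolymatroid

open Finset

/-! ### Bases of transversal polymatroids and Hall's theorem -/

section Hall

variable {n m : ℕ}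

theorem sum_sum_single (f : Fin m → Fin n) (T : Finset (Fin n)) :
    ∑ j ∈ T, (∑ k, Finsupp.single (f k) 1 : Fin n →₀ ℕ) j = #{k | f k ∈ T} := by
  simp only [Finsupp.finsetSum_apply, Finsupp.single_apply]
  rw [Finset.sum_comm]
  simp

/-- Membership in the base of a transversal polymatroid is a matching problem: `α` stands for a
multiset of `m` slots, and each `C k` has to be matched with a slot lying over it. -/
theorem mem_exponents_iff (C : Fin m → Finset (Fin n)) (α : Fin n →₀ ℕ) :
    α ∈ exponents C ↔ ∑ j, α j = m ∧ ∀ V, #{k | C k ⊆ V} ≤ ∑ j ∈ V, α j := by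
  constructor
  · rintro ⟨f, hf, rfl⟩
    refine ⟨by rw [sum_sum_single]; simp, fun V => ?_⟩
    rw [sum_sum_single]
    refine card_le_card fun k hk => ?_
    simp only [mem_filter, mem_univ, true_and] at hk ⊢
    exact hk (hf k)
  · rintro ⟨hsum, hV⟩
    let t : Fin m → Finset (Σ j : Fin n, Fin (α j)) := fun k => (C k).sigma fun _ => univ
    have hall : ∀ I : Finset (Fin m), #I ≤ #(I.biUnion t) := by
      intro I
      have h₁ : I.biUnion t = (I.biUnion C).sigma fun _ => univ := by
        ext x
        simp [t]
      rw [h₁, card_sigma]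
      simp only [card_univ, Fintype.card_fin]
      refine le_trans (card_le_card fun k hk => ?_) (hV (I.biUnion C))
      simpa using subset_biUnion_of_mem C hk
    obtain ⟨g, hg, hgt⟩ := (all_card_le_biUnion_card_iff_exists_injective t).1 hall
    have hbij : Function.Bijective g := by
      rw [Fintype.bijective_iff_injective_and_card]
      refine ⟨hg, ?_⟩
      simp [hsum]
    refine ⟨fun k => (g k).1, fun k => (mem_sigma.1 (hgt k)).1, ?_⟩
    ext j
    have h₂ := sum_sum_single (fun k => (g k).1) {j}
    rw [sum_singleton] at h₂
    rw [h₂]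
    have h₃ : #{k | (g k).1 ∈ ({j} : Finset (Fin n))} =
        #({x | x.1 = j} : Finset (Σ j : Fin n, Fin (α j))) :=
      card_bij (fun k _ => g k) (by simp) (fun _ _ _ _ h => hg h) fun x hx => by
        obtain ⟨k, rfl⟩ := hbij.2 x
        exact ⟨k, by simpa using hx, rfl⟩
    have h₄ : ({x | x.1 = j} : Finset (Σ j : Fin n, Fin (α j))) =
        ({j} : Finset (Fin n)).sigma fun _ => univ := by
      ext x
      simp
    rw [h₃, h₄, card_sigma]
    simp

/-- The family whose `k`-th member is the intersection of those of `U₁`, `U₂` for which `k` lies in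
`P₁`, respectively in `P₂`. -/
def meetFamily (P₁ P₂ : Finset (Fin m)) (U₁ U₂ : Finset (Fin n)) (k : Fin m) : Finset (Fin n) :=
  (if k ∈ P₁ then U₁ else univ) ∩ (if k ∈ P₂ then U₂ else univ)

theorem mem_exponents_meetFamily_iff (P₁ P₂ : Finset (Fin m)) (U₁ U₂ : Finset (Fin n))
    (α : Fin n →₀ ℕ) :
    α ∈ exponents (meetFamily P₁ P₂ U₁ U₂) ↔ ∑ j, α j = m ∧
      #P₁ ≤ ∑ j ∈ U₁, α j ∧ #P₂ ≤ ∑ j ∈ U₂, α j ∧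
      #(P₁ ∩ P₂) ≤ ∑ j ∈ U₁ ∩ U₂, α j ∧ #(P₁ ∪ P₂) ≤ ∑ j ∈ U₁ ∪ U₂, α j := by
  rw [mem_exponents_iff]
  refine and_congr_right fun hsum => ⟨fun h => ?_, ?_⟩
  · have key : ∀ (Q : Finset (Fin m)) (V : Finset (Fin n)),
        (∀ k ∈ Q, meetFamily P₁ P₂ U₁ U₂ k ⊆ V) → #Q ≤ ∑ j ∈ V, α j := fun Q V hQ =>
      le_trans (card_le_card fun k hk => by simpa using hQ k hk) (h V)
    refine ⟨key _ _ ?_, key _ _ ?_, key _ _ ?_, key _ _ ?_⟩ <;> intro k hk j hj <;>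
      simp only [meetFamily, mem_inter, mem_union] at hj hk ⊢ <;> split_ifs at hj <;> simp_all
  · rintro ⟨h₁, h₂, h₃, h₄⟩ V
    have mono : ∀ U, U ⊆ V → ∑ j ∈ U, α j ≤ ∑ j ∈ V, α j := fun U hU =>
      sum_le_sum_of_subset hU
    have key : ∀ (Q : Finset (Fin m)) (U : Finset (Fin n)), #Q ≤ ∑ j ∈ U, α j → U ⊆ V →
        (∀ k, meetFamily P₁ P₂ U₁ U₂ k ⊆ V → k ∈ Q) →
        #{k | meetFamily P₁ P₂ U₁ U₂ k ⊆ V} ≤ ∑ j ∈ V, α j := fun Q U hQ hU hk =>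
      le_trans (card_le_card fun k hk' => hk k (by simpa using hk')) (hQ.trans (mono U hU))
    -- The members contained in `V` depend only on which of `U₁`, `U₂`, `U₁ ∩ U₂` and `[n]` are.
    by_cases hV : V = univ
    · subst hV
      rw [hsum]
      exact (card_le_univ _).trans (by simp)
    have hV' : ¬ (univ : Finset (Fin n)) ⊆ V := fun h => hV (univ_subset_iff.1 h)
    by_cases hU₁ : U₁ ⊆ V <;> by_cases hU₂ : U₂ ⊆ V
    · refine key _ _ h₄ (union_subset hU₁ hU₂) fun k hk => ?_
      unfold meetFamily at hk
      split_ifs at hk <;> simp_all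
    · refine key _ _ h₁ hU₁ fun k hk => ?_
      unfold meetFamily at hk
      split_ifs at hk <;> simp_all
    · refine key _ _ h₂ hU₂ fun k hk => ?_
      unfold meetFamily at hk
      split_ifs at hk <;> simp_all
    · by_cases hU : U₁ ∩ U₂ ⊆ V
      · refine key _ _ h₃ hU fun k hk => ?_
        unfold meetFamily at hk
        split_ifs at hk <;> simp_all
      · refine key ∅ ∅ (by simp) (by simp) fun k hk => ?_
        unfold meetFamily at hk
        split_ifs at hk <;> simp_all

end Hall

/-! ### Submodularity -/

section Coverage

variable {n m : ℕ}

/-- The number of members of the family `C` that meet `T`; this is the rank function of the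
transversal polymatroid presented by `C`. -/
def hitCount (C : Fin m → Finset (Fin n)) (T : Finset (Fin n)) : ℕ :=
  #{k | (C k ∩ T).Nonempty}

theorem hitCount_submodular (C : Fin m → Finset (Fin n)) (S T : Finset (Fin n)) :
    hitCount C (S ∪ T) + hitCount C (S ∩ T) ≤ hitCount C S + hitCount C T := by
  unfold hitCount
  rw [← card_union_add_card_inter (filter (fun k => (C k ∩ S).Nonempty) univ)]
  refine add_le_add (card_le_card fun k => ?_) (card_le_card fun k => ?_)
  · simp only [mem_filter, mem_univ, true_and, mem_union, inter_union_distrib_left,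
      union_nonempty, imp_self]
  · simp only [mem_filter, mem_univ, true_and, mem_inter]
    rintro ⟨j, hj⟩
    simp only [mem_inter] at hj
    exact ⟨⟨j, by simp [hj]⟩, ⟨j, by simp [hj]⟩⟩

theorem sum_le_hitCount {C : Fin m → Finset (Fin n)} {α : Fin n →₀ ℕ} (hα : α ∈ exponents C)
    (T : Finset (Fin n)) : ∑ j ∈ T, α j ≤ hitCount C T := by
  obtain ⟨f, hf, rfl⟩ := hα
  rw [sum_sum_single]
  refine card_le_card fun k hk => ?_
  simp only [mem_filter, mem_univ, true_and] at hk ⊢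
  exact ⟨f k, mem_inter.2 ⟨hf k, hk⟩⟩

theorem exists_hitCount_le_sum {C : Fin m → Finset (Fin n)} (hC : ∀ k, (C k).Nonempty)
    (T : Finset (Fin n)) : ∃ α ∈ exponents C, hitCount C T ≤ ∑ j ∈ T, α j := by
  have h : ∀ k, ∃ j ∈ C k, (C k ∩ T).Nonempty → j ∈ T := by
    intro k
    by_cases hk : (C k ∩ T).Nonempty
    · obtain ⟨j, hj⟩ := hk
      exact ⟨j, (mem_inter.1 hj).1, fun _ => (mem_inter.1 hj).2⟩
    · obtain ⟨j, hj⟩ := hC k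
      exact ⟨j, hj, fun h => absurd h hk⟩
  choose f hf hfT using h
  refine ⟨_, ⟨f, hf, rfl⟩, ?_⟩
  rw [sum_sum_single]
  refine card_le_card fun k hk => ?_
  simp only [mem_filter, mem_univ, true_and] at hk ⊢
  exact hfT k hk

end Coverage

/-! ### Two capacity constraints -/

section Capacity

variable {n : ℕ}

/-- The vectors `α` of degree `n` with `α(S₁) ≤ |S₁| + 1` and `α(S₂) ≤ |S₂| + 1`. -/
def cappedVectors (S₁ S₂ : Finset (Fin n)) : Set (Fin n →₀ ℕ) :=
  {α | ∑ j, α j = n ∧ ∑ j ∈ S₁, α j ≤ #S₁ + 1 ∧ ∑ j ∈ S₂, α j ≤ #S₂ + 1}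

theorem cappedVectors_comm (S₁ S₂ : Finset (Fin n)) :
    cappedVectors S₁ S₂ = cappedVectors S₂ S₁ := by
  ext α
  simp only [cappedVectors, Set.mem_ofPred_eq]
  tauto

theorem cappedVectors_nonempty (S₁ S₂ : Finset (Fin n)) : (cappedVectors S₁ S₂).Nonempty :=
  ⟨Finsupp.equivFunOnFinite.symm fun _ => 1, by simp [cappedVectors]⟩

/-- Passing to complements turns the two upper bounds into the lower bounds of
`mem_exponents_meetFamily_iff`. -/
theorem exponents_meetFamily_eq_cappedVectors {S₁ S₂ : Finset (Fin n)} {P₁ P₂ : Finset (Fin n)}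
    (hP₁ : #P₁ + 1 + #S₁ = n) (hP₂ : #P₂ + 1 + #S₂ = n)
    (h : ∀ α : Fin n →₀ ℕ, ∑ j, α j = n → #P₁ ≤ ∑ j ∈ S₁ᶜ, α j → #P₂ ≤ ∑ j ∈ S₂ᶜ, α j →
      #(P₁ ∩ P₂) ≤ ∑ j ∈ S₁ᶜ ∩ S₂ᶜ, α j ∧ #(P₁ ∪ P₂) ≤ ∑ j ∈ S₁ᶜ ∪ S₂ᶜ, α j) :
    exponents (meetFamily P₁ P₂ S₁ᶜ S₂ᶜ) = cappedVectors S₁ S₂ := by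
  ext α
  rw [mem_exponents_meetFamily_iff]
  simp only [cappedVectors, Set.mem_ofPred_eq]
  refine and_congr_right fun hα => ?_
  have h₁ := sum_add_sum_compl S₁ α
  have h₂ := sum_add_sum_compl S₂ α
  constructor
  · rintro ⟨h₃, h₄, -⟩
    omega
  · rintro ⟨h₃, h₄⟩
    have h₅ : #P₁ ≤ ∑ j ∈ S₁ᶜ, α j := by omega
    have h₆ : #P₂ ≤ ∑ j ∈ S₂ᶜ, α j := by omega
    exact ⟨h₅, h₆, h α hα h₅ h₆⟩

theorem exists_presentation_of_subset {S₁ S₂ : Finset (Fin n)} (h : S₁ ⊆ S₂) (hS₂ : #S₂ + 1 ≤ n) :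
    ∃ C : Fin n → Finset (Fin n), exponents C = cappedVectors S₁ S₂ := by
  have h₁ := card_le_card h
  obtain ⟨P₁, -, hP₁⟩ := exists_subset_card_eq (s := (univ : Finset (Fin n))) (n := n - 1 - #S₁)
    (by simp; omega)
  obtain ⟨P₂, hP, hP₂⟩ := exists_subset_card_eq (s := P₁) (n := n - 1 - #S₂) (by omega)
  refine ⟨_, exponents_meetFamily_eq_cappedVectors (P₁ := P₁) (P₂ := P₂)
    (by omega) (by omega) fun α hα h₃ h₄ => ?_⟩
  rw [inter_eq_right.2 hP, union_eq_left.2 hP, inter_eq_right.2 (compl_subset_compl.2 h),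
    union_eq_left.2 (compl_subset_compl.2 h)]
  exact ⟨h₄, h₃⟩

/-- Index sets of prescribed sizes that overlap as little as possible. -/
theorem exists_min_inter {p₁ p₂ : ℕ} (h₁ : p₁ ≤ n) (h₂ : p₂ ≤ n) :
    ∃ P₁ P₂ : Finset (Fin n), #P₁ = p₁ ∧ #P₂ = p₂ ∧ #(P₁ ∩ P₂) = p₁ + p₂ - n := by
  obtain ⟨P₁, -, hP₁⟩ := exists_subset_card_eq (s := (univ : Finset (Fin n))) (n := p₁) (by simpa)
  have hc : #P₁ᶜ = n - p₁ := by simp [card_compl, hP₁]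
  refine ⟨P₁, ?_⟩
  rcases le_total (p₁ + p₂) n with h | h
  · obtain ⟨P₂, hP, hP₂⟩ := exists_subset_card_eq (s := P₁ᶜ) (n := p₂) (by omega)
    refine ⟨P₂, hP₁, hP₂, ?_⟩
    rw [disjoint_iff_inter_eq_empty.1 (disjoint_compl_right.mono_right hP), card_empty]
    omega
  · obtain ⟨P₂, hP, -, hP₂⟩ := exists_subsuperset_card_eq (subset_univ P₁ᶜ) (n := p₂) (by omega)
      (by simpa)
    refine ⟨P₂, hP₁, hP₂, ?_⟩
    have h₃ : P₁ ∪ P₂ = univ := by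
      ext j
      by_cases hj : j ∈ P₁
      · simp [hj]
      · simp [hP (mem_compl.2 hj)]
    have h₄ := card_union_add_card_inter P₁ P₂
    rw [h₃, card_univ, Fintype.card_fin] at h₄
    omega

theorem exists_presentation_of_disjoint_or_union_eq_univ {S₁ S₂ : Finset (Fin n)}
    (h : Disjoint S₁ S₂ ∨ S₁ ∪ S₂ = univ) (hS₁ : #S₁ + 1 ≤ n) (hS₂ : #S₂ + 1 ≤ n) :
    ∃ C : Fin n → Finset (Fin n), exponents C = cappedVectors S₁ S₂ := by
  obtain ⟨P₁, P₂, hP₁, hP₂, hP⟩ := exists_min_inter (n := n) (p₁ := n - 1 - #S₁)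
    (p₂ := n - 1 - #S₂) (by omega) (by omega)
  refine ⟨_, exponents_meetFamily_eq_cappedVectors (P₁ := P₁) (P₂ := P₂)
    (by omega) (by omega) fun α hα h₃ h₄ => ?_⟩
  have h₅ := card_union_add_card_inter P₁ P₂
  have h₆ := sum_union_inter (s₁ := S₁ᶜ) (s₂ := S₂ᶜ) (f := α)
  have h₇ : #(P₁ ∪ P₂) ≤ n := (card_le_univ _).trans (by simp)
  have h₈ : ∑ j ∈ S₁ᶜ ∪ S₂ᶜ, α j ≤ n :=
    (sum_le_sum_of_subset (subset_univ _)).trans hα.le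
  rcases h with h | h
  · rw [← compl_inter, disjoint_iff_inter_eq_empty.1 h, compl_empty, hα] at h₆ ⊢
    omega
  · -- The complements are disjoint, of total size at most `n`, so `P₁` and `P₂` are disjoint.
    rw [← compl_union, h, compl_univ, sum_empty] at h₆ ⊢
    have h₉ := card_union_add_card_inter S₁ S₂
    rw [h, card_univ, Fintype.card_fin] at h₉
    omega

/-- If `S₁` and `S₂` cross, then the rank function of a presentation of `cappedVectors S₁ S₂`
would violate submodularity at `S₁` and `S₂`. -/
theorem not_crossing_of_exponents_eq {m : ℕ} {C : Fin m → Finset (Fin n)} {S₁ S₂ : Finset (Fin n)}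
    (hC : ∀ k, (C k).Nonempty) (h : exponents C = cappedVectors S₁ S₂)
    (hS₁ : #S₁ + 2 ≤ n) (hS₂ : #S₂ + 2 ≤ n) :
    S₁ ⊆ S₂ ∨ S₂ ⊆ S₁ ∨ Disjoint S₁ S₂ ∨ S₁ ∪ S₂ = univ := by
  by_contra! hcon
  obtain ⟨h₁, h₂, h₃, h₄⟩ := hcon
  obtain ⟨x, hx₁, hx₂⟩ := not_subset.1 h₁
  obtain ⟨y, hy₂, hy₁⟩ := not_subset.1 h₂
  obtain ⟨w, hw₁, hw₂⟩ := not_disjoint_iff.1 h₃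
  obtain ⟨z, hz⟩ : ∃ z, z ∉ S₁ ∪ S₂ := by
    by_contra! hz
    exact h₄ (eq_univ_iff_forall.2 hz)
  rw [mem_union, not_or] at hz
  obtain ⟨hz₁, hz₂⟩ := hz
  have hr₁ : hitCount C S₁ ≤ #S₁ + 1 := by
    obtain ⟨α, hα, hle⟩ := exists_hitCount_le_sum hC S₁
    rw [h] at hα
    exact hle.trans hα.2.1
  have hr₂ : hitCount C S₂ ≤ #S₂ + 1 := by
    obtain ⟨α, hα, hle⟩ := exists_hitCount_le_sum hC S₂
    rw [h] at hα
    exact hle.trans hα.2.2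
  have sum_single : ∀ (T : Finset (Fin n)) (v : Fin n) (a : ℕ),
      ∑ j ∈ T, Finsupp.single v a j = if v ∈ T then a else 0 := by
    intro T v a
    simp [Finsupp.single_apply]
  -- Test vectors: as much as possible on `w`, respectively on `x` and `y`, and the rest on `z`.
  have hr₃ : min (#S₁) (#S₂) + 1 ≤ hitCount C (S₁ ∩ S₂) := by
    have hmem : Finsupp.single w (min (#S₁) (#S₂) + 1) +
        Finsupp.single z (n - (min (#S₁) (#S₂) + 1)) ∈ exponents C := by
      rw [h]
      simp only [cappedVectors, Set.mem_ofPred_eq, Finsupp.add_apply, sum_add_distrib, sum_single,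
        mem_univ, hw₁, hw₂, hz₁, hz₂, if_true, if_false]
      omega
    have hle := sum_le_hitCount hmem (S₁ ∩ S₂)
    simp only [Finsupp.add_apply, sum_add_distrib, sum_single, mem_inter, hw₁, hw₂, hz₁,
      true_and, false_and, if_true, if_false] at hle
    exact hle
  have hr₄ : min n (#S₁ + #S₂ + 2) ≤ hitCount C (S₁ ∪ S₂) := by
    have hmem : Finsupp.single x (#S₁ + 1) + Finsupp.single y (min (#S₂ + 1) (n - (#S₁ + 1))) +
        Finsupp.single z (n - (#S₁ + #S₂ + 2)) ∈ exponents C := by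
      rw [h]
      simp only [cappedVectors, Set.mem_ofPred_eq, Finsupp.add_apply, sum_add_distrib, sum_single,
        mem_univ, hx₁, hx₂, hy₁, hy₂, hz₁, hz₂, if_true, if_false]
      omega
    have hle := sum_le_hitCount hmem (S₁ ∪ S₂)
    simp only [Finsupp.add_apply, sum_add_distrib, sum_single, mem_union, hx₁, hy₂, hz₁, hz₂,
      true_or, or_true, or_self, if_true, if_false] at hle
    omega
  have := hitCount_submodular C S₁ S₂
  omega

end Capacity

/-! ### Monomial algebras with generators of one degree -/

section MonomialAlgebra

variable {n : ℕ} (K : Type*) [Field K]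

theorem support_subset_closure {S : Set (Fin n →₀ ℕ)} {p : MvPolynomial (Fin n) K}
    (hp : p ∈ monomialAlgebra K S) :
    ∀ α ∈ p.support, α ∈ AddSubmonoid.closure S := by
  classical
  unfold monomialAlgebra at hp
  induction hp using Algebra.adjoin_induction with
  | mem p hp =>
    obtain ⟨β, hβ, rfl⟩ := hp
    intro α hα
    have := MvPolynomial.support_monomial_subset hα
    rw [mem_singleton] at this
    exact this ▸ AddSubmonoid.subset_closure hβ
  | algebraMap r =>
    intro α hα
    rw [MvPolynomial.algebraMap_eq, MvPolynomial.C_apply] at hα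
    have := MvPolynomial.support_monomial_subset hα
    rw [mem_singleton] at this
    exact this ▸ zero_mem _
  | add p q _ _ hp hq =>
    intro α hα
    rcases mem_union.1 (MvPolynomial.support_add hα) with h | h
    exacts [hp α h, hq α h]
  | mul p q _ _ hp hq =>
    intro α hα
    obtain ⟨β, hβ, γ, hγ, rfl⟩ := mem_add.1 (MvPolynomial.support_mul p q hα)
    exact add_mem (hp β hβ) (hq γ hγ)

/-- A sum of two or more nonzero generators has at least twice their common degree. -/
theorem eq_zero_or_mem_or_le_of_mem_closure {S : Set (Fin n →₀ ℕ)} {d : ℕ}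
    (hS : ∀ α ∈ S, ∑ j, α j = d) {α : Fin n →₀ ℕ} (hα : α ∈ AddSubmonoid.closure S) :
    α = 0 ∨ α ∈ S ∨ 2 * d ≤ ∑ j, α j := by
  induction hα using AddSubmonoid.closure_induction with
  | mem α h => exact Or.inr (Or.inl h)
  | zero => exact Or.inl rfl
  | add α β _ _ hα hβ =>
    rcases hα with rfl | hα
    · simpa using hβ
    rcases hβ with rfl | hβ
    · simpa using Or.inr hα
    refine Or.inr (Or.inr ?_)
    have h₁ : d ≤ ∑ j, α j := hα.elim (fun h => (hS α h).ge) (by omega)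
    have h₂ : d ≤ ∑ j, β j := hβ.elim (fun h => (hS β h).ge) (by omega)
    simp only [Finsupp.add_apply, sum_add_distrib]
    omega

theorem mem_or_two_mul_le_of_monomialAlgebra_le {S T : Set (Fin n →₀ ℕ)} {d e : ℕ}
    (hS : ∀ α ∈ S, ∑ j, α j = d) (hT : ∀ α ∈ T, ∑ j, α j = e) (hd : 0 < d)
    (h : monomialAlgebra K S ≤ monomialAlgebra K T) {α : Fin n →₀ ℕ} (hα : α ∈ S) :
    α ∈ T ∨ 2 * e ≤ d := by
  have h₁ : MvPolynomial.monomial α (1 : K) ∈ monomialAlgebra K T :=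
    h (Algebra.subset_adjoin ⟨α, hα, rfl⟩)
  have h₂ := support_subset_closure K h₁ α (by simp [MvPolynomial.mem_support_iff])
  rcases eq_zero_or_mem_or_le_of_mem_closure hT h₂ with rfl | h₃ | h₃
  · have := hS _ hα
    simp at this
    omega
  · exact Or.inl h₃
  · exact Or.inr (hS α hα ▸ h₃)

theorem eq_of_monomialAlgebra_eq {S T : Set (Fin n →₀ ℕ)} {d e : ℕ}
    (hS : ∀ α ∈ S, ∑ j, α j = d) (hT : ∀ α ∈ T, ∑ j, α j = e) (hd : 0 < d) (he : 0 < e)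
    (hSne : S.Nonempty) (hTne : T.Nonempty) (h : monomialAlgebra K S = monomialAlgebra K T) :
    S = T := by
  obtain ⟨α, hα⟩ := hSne
  obtain ⟨β, hβ⟩ := hTne
  -- Each of `S`, `T` has an element in the other, or degree at least twice that of the other.
  have hde : d = e := by
    have h₁ := mem_or_two_mul_le_of_monomialAlgebra_le K hS hT hd h.le hα
    have h₂ := mem_or_two_mul_le_of_monomialAlgebra_le K hT hS he h.ge hβ
    rcases h₁ with h₁ | h₁
    · rw [← hS α hα, hT α h₁]
    rcases h₂ with h₂ | h₂
    · rw [← hT β hβ, hS β h₂]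
    omega
  subst hde
  refine Set.Subset.antisymm (fun γ hγ => ?_) fun γ hγ => ?_
  · exact (mem_or_two_mul_le_of_monomialAlgebra_le K hS hT hd h.le hγ).resolve_right (by omega)
  · exact (mem_or_two_mul_le_of_monomialAlgebra_le K hT hS hd h.ge hγ).resolve_right (by omega)

/-- The ring generated by `cappedVectors S₁ S₂` is a transversal base ring exactly when `S₁` and
`S₂` do not cross. -/
theorem isTransversalBaseRing_cappedVectors_iff {S₁ S₂ : Finset (Fin n)}
    (hS₁ : #S₁ + 2 ≤ n) (hS₂ : #S₂ + 2 ≤ n) :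
    IsTransversalBaseRing K (monomialAlgebra K (cappedVectors S₁ S₂)) ↔
      S₁ ⊆ S₂ ∨ S₂ ⊆ S₁ ∨ Disjoint S₁ S₂ ∨ S₁ ∪ S₂ = univ := by
  constructor
  · rintro ⟨m, hm, C, hC, h⟩
    have hne : (exponents C).Nonempty :=
      (exists_hitCount_le_sum hC ∅).imp fun _ h => h.1
    have h₁ := eq_of_monomialAlgebra_eq K (d := n) (e := m) (fun α hα => hα.1)
      (fun α hα => ((mem_exponents_iff C α).1 hα).1) (by omega) (by omega)
      (cappedVectors_nonempty S₁ S₂) hne h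
    exact not_crossing_of_exponents_eq hC h₁.symm hS₁ hS₂
  · intro h
    have hex : ∃ C : Fin n → Finset (Fin n), exponents C = cappedVectors S₁ S₂ := by
      rcases h with h | h | h
      · exact exists_presentation_of_subset h (by omega)
      · rw [cappedVectors_comm]
        exact exists_presentation_of_subset h (by omega)
      · exact exists_presentation_of_disjoint_or_union_eq_univ h (by omega) (by omega)
    obtain ⟨C, hC⟩ := hex
    refine ⟨n, by omega, C, fun k => ?_, by rw [baseRing, hC]⟩
    -- The base is nonempty, so every member of the presentation is.
    obtain ⟨α, hα⟩ := cappedVectors_nonempty S₁ S₂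
    rw [← hC] at hα
    obtain ⟨f, hf, -⟩ := hα
    exact ⟨f k, hf k⟩

end MonomialAlgebra

/-! ### Cyclic intervals -/

section Cyclic

variable {n : ℕ}

theorem val_sigma_pow (t : ℕ) (k : Fin n) : ((sigma n ^ t) k).val = (k.val + t) % n := by
  induction t with
  | zero => simp [Nat.mod_eq_of_lt k.isLt]
  | succ t ih =>
    rw [pow_succ', Equiv.Perm.mul_apply]
    obtain ⟨r, rfl⟩ : ∃ r, n = r + 1 := ⟨n - 1, by have := k.isLt; omega⟩
    rw [sigma, finRotate_apply, Fin.val_add, ← sigma, ih, Fin.val_one', ← Nat.add_mod,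
      add_assoc]

theorem mem_sigmaSet_iff {t i : ℕ} (ht : t < n) (hi : i ≤ n) (j : Fin n) :
    j ∈ sigmaSet n t i ↔ (t ≤ j.val ∧ j.val < t + i) ∨ j.val + n < t + i := by
  have hj := j.isLt
  simp only [sigmaSet, initial, mem_image, mem_filter, mem_univ, true_and, Fin.ext_iff,
    val_sigma_pow]
  constructor
  · rintro ⟨k, hk, h⟩
    rcases lt_or_ge (k.val + t) n with h' | h'
    · rw [Nat.mod_eq_of_lt h'] at h
      omega
    · rw [Nat.mod_eq_sub_mod h', Nat.mod_eq_of_lt (by omega)] at h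
      omega
  · rintro (h | h)
    · exact ⟨⟨j.val - t, by omega⟩, by simp only; omega, by
        simp only
        rw [Nat.mod_eq_of_lt (by omega)]
        omega⟩
    · exact ⟨⟨j.val + n - t, by omega⟩, by simp only; omega, by
        simp only
        rw [Nat.mod_eq_sub_mod (by omega), Nat.mod_eq_of_lt (by omega)]
        omega⟩

theorem card_initial {i : ℕ} (hi : i ≤ n) : #(initial n i) = i := by
  have : initial n i = (univ : Finset (Fin i)).map (Fin.castLEEmb hi) := by
    ext k
    simp only [initial, mem_filter, mem_univ, true_and, mem_map, Fin.castLEEmb_apply]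
    exact ⟨fun h => ⟨⟨k, h⟩, rfl⟩, by rintro ⟨l, rfl⟩; exact l.isLt⟩
  rw [this, card_map, card_univ, Fintype.card_fin]

theorem card_sigmaSet {t i : ℕ} (hi : i ≤ n) : #(sigmaSet n t i) = i := by
  rw [sigmaSet, card_image_of_injective _ (sigma n ^ t).injective, card_initial hi]

theorem mem_exponents_presentation_iff {t i : ℕ} (hi : i + 1 ≤ n) (α : Fin n →₀ ℕ) :
    α ∈ exponents (presentation n t i) ↔
      ∑ j, α j = n ∧ ∑ j ∈ sigmaSet n t i, α j ≤ #(sigmaSet n t i) + 1 := by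
  -- The indices of the members different from `[n]`, before the shift by `t`.
  let Q : Finset (Fin n) := {k | ¬ (k ∈ initial n i ∨ k.val + 1 = n)}
  let P : Finset (Fin n) := Q.map (sigma n ^ t).toEmbedding
  have hQ : #P + 1 + i = n := by
    have h₁ : Qᶜ = insert ⟨n - 1, by omega⟩ (initial n i) := by
      ext k
      simp only [Q, initial, mem_compl, mem_filter, mem_univ, true_and, mem_insert, Fin.ext_iff]
      have := k.isLt
      omega
    have h₂ : #Qᶜ = i + 1 := by
      rw [h₁, card_insert_of_notMem (by simp [initial]; omega), card_initial (by omega)]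
    have h₃ := card_add_card_compl Q
    rw [Fintype.card_fin] at h₃
    rw [card_map]
    omega
  have hpres : presentation n t i = meetFamily P ∅ (sigmaSet n t i)ᶜ univ := by
    funext j
    have hj : j ∈ P ↔ ¬ ((sigma n ^ t)⁻¹ j ∈ initial n i ∨ ((sigma n ^ t)⁻¹ j).val + 1 = n) := by
      simp only [P, mem_map_equiv, Q, mem_filter, mem_univ, true_and]
      rfl
    simp only [presentation, meetFamily, hj]
    split_ifs <;> simp_all [compl_eq_univ_sdiff]
  rw [hpres, mem_exponents_meetFamily_iff, card_sigmaSet (by omega)]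
  refine and_congr_right fun hα => ?_
  have h₁ := sum_add_sum_compl (sigmaSet n t i) α
  simp only [card_empty, inter_empty, inter_univ, union_empty,
    union_eq_right.2 (subset_univ _), hα]
  omega

theorem exponents_presentation_inter {s t i j : ℕ} (hi : i + 1 ≤ n) (hj : j + 1 ≤ n) :
    exponents (presentation n s i) ∩ exponents (presentation n t j) =
      cappedVectors (sigmaSet n s i) (sigmaSet n t j) := by
  ext α
  simp only [Set.mem_inter_iff, mem_exponents_presentation_iff hi, mem_exponents_presentation_iff hj,
    cappedVectors, Set.mem_ofPred_eq]
  tauto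

end Cyclic

end TransversalPolymatroid

theorem theorem4p1 (K : Type*) [Field K] (n i₁ i₂ t₂ : ℕ)
    (hi₁ : 1 ≤ i₁) (hi₁n : i₁ ≤ n - 2) (hi₂ : 1 ≤ i₂) (hi₂n : i₂ ≤ n - 2) (ht₂ : t₂ ≤ n - 1) :
    TransversalPolymatroid.IsTransversalBaseRing K
        (TransversalPolymatroid.monomialAlgebra K
          (TransversalPolymatroid.exponents (TransversalPolymatroid.presentation n 0 i₁) ∩
            TransversalPolymatroid.exponents (TransversalPolymatroid.presentation n t₂ i₂))) ↔
      i₁ = 1 ∨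
      (2 ≤ i₁ ∧ t₂ = 0) ∨
      (2 ≤ i₁ ∧ t₂ = i₁) ∨
      (2 ≤ i₁ ∧ 1 ≤ t₂ ∧ t₂ ≤ i₁ - 1 ∧
        i₂ ∈ Set.Icc 1 (i₁ - t₂) ∪ Set.Icc (n - t₂) (n - 2)) ∨
      (2 ≤ i₁ ∧ i₁ + 1 ≤ t₂ ∧ t₂ ≤ n - 1 ∧
        i₂ ∈ Set.Icc 1 (n - t₂) ∪ Set.Icc (n - t₂ + i₁) (n - 2)) := by
  open TransversalPolymatroid Finset in
  rw [exponents_presentation_inter (by omega) (by omega),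
    isTransversalBaseRing_cappedVectors_iff K (by rw [card_sigmaSet] <;> omega)
      (by rw [card_sigmaSet] <;> omega)]
  have m₁ := mem_sigmaSet_iff (n := n) (t := 0) (i := i₁) (by omega) (by omega)
  have m₂ := mem_sigmaSet_iff (n := n) (t := t₂) (i := i₂) (by omega) (by omega)
  simp only [Finset.subset_iff, Finset.disjoint_left, Finset.eq_univ_iff_forall, Finset.mem_union,
    m₁, m₂, Fin.forall_iff, Set.mem_union, Set.mem_Icc]
  constructor
  · intro h
    by_contra hcon
    rcases lt_or_ge t₂ i₁ with ht | ht
    · -- `S₂ = [t₂, t₂ + i₂)` does not wrap around; the points `0`, `i₁`, `t₂`, `n - 1` lie in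
      -- `S₁ ∖ S₂`, `S₂ ∖ S₁`, `S₁ ∩ S₂` and outside `S₁ ∪ S₂`.
      rcases h with h | h | h | h
      · have := @h 0 (by omega)
        omega
      · have := @h i₁ (by omega)
        omega
      · have := @h t₂ (by omega)
        omega
      · have := @h (n - 1) (by omega)
        omega
    · -- `S₂` wraps around; the corresponding points are `i₁ - 1`, `t₂`, `0`, `i₁`.
      rcases h with h | h | h | h
      · have := @h (i₁ - 1) (by omega)
        omega
      · have := @h t₂ (by omega)
        omega
      · have := @h 0 (by omega)
        omega
      · have := @h i₁ (by omega)
        omega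
  · intro h
    rcases Nat.eq_zero_or_pos t₂ with h₀ | h₀
    · rcases le_total i₁ i₂ with h' | h'
      · exact Or.inl fun j hj => by omega
      · exact Or.inr (Or.inl fun j hj => by omega)
    rcases lt_or_ge t₂ i₁ with ht | ht
    · rcases le_or_gt i₂ (i₁ - t₂) with h' | h'
      · exact Or.inr (Or.inl fun j hj => by omega)
      · exact Or.inr (Or.inr (Or.inr fun j hj => by omega))
    · rcases le_or_gt i₂ (n - t₂) with h' | h'
      · exact Or.inr (Or.inr (Or.inl fun j hj => by omega))
      · rcases eq_or_ne t₂ i₁ with h'' | h''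
        · exact Or.inr (Or.inr (Or.inr fun j hj => by omega))
        · exact Or.inl fun j hj => by omega
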